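/- Let $G$ be a finite undirected graph with vertex set $V\neq\emptyset$, $|V|=n$. Parallel edges are allowed, as are self-loops, but with at most one self-loop at each vertex. For $k\ge 1$, a $k$-cycle is a graph with $k$ distinct vertices $v_0,\dots,v_{k-1}$ and $k$ distinct edges $e_0,\dots,e_{k-1}$, where $e_i$ joins $v_i$ to $v_{i+1}$ (indices modulo $k$); thus a $1$-cycle is a vertex with a self-loop and a $2$-cycle is a pair of vertices joined by two parallel edges. An orientation of an edge designates one of its ends as head and the other as tail (a self-loop has only one orientation, every other edge has two). A sink of an orientation of $G$ is a vertex that is not the tail of any edge. Sink popping on $G$ is the following procedure. Let $X_{e,k}$ ($e\in E(G)$, $k\ge 0$) be independent random variables, $X_{e,k}$ being uniformly distributed on the orientations of $e$. Put $f(e,0)=0$ for all $e$. At time $k\ge 0$, if the orientation $(X_{e,f(e,k)})_{e\in E(G)}$ has no sink, set $f(e,k+1)=f(e,k)$ for all $e$ (no vertex is popped). Otherwise choose one of its sinks, $v_k$, according to an arbitrary choice rule (which may depend on $k$ and on all the variables $X_{e,j}$), pop it, i.e. set $f(e,k+1)=f(e,k)+1$ for each edge $e$ incident to $v_k$, and $f(e,k+1)=f(e,k)$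 for every other edge $e$. Let $Q(G,v)\in\{0,1,2,\dots\}\cup\{\infty\}$ be the total number of times $k$ at which the vertex $v$ is popped. Suppose that every vertex of $G$ lies on some cycle, i.e. belongs to a subgraph of $G$ that is a $k$-cycle for some $k\ge 1$. Then, for every choice rule, each $Q(G,v)$, $v\in V$, is a random variable (measurable up to a null set) and $$\mathbf{E}\,Q(G,v)\le \frac{n-1}{2}\qquad\text{for every } v\in V.$$ Moreover, for every choice rule, equality holds for all $v\in V$ if and only if $G$ is an $n$-cycle. -/

import Mathlib

open MeasureTheory ProbabilityTheory
open scoped Graph ENNReal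

namespace Graph

/-- An orientation of a single edge `e`: one end of `e` is declared to be the tail, the other the
head. An edge that is not a loop has exactly two orientations, a loop has exactly one. -/
@[ext]
structure Arrow {α β : Type*} (G : Graph α β) (e : E(G)) where
  tail : α
  head : α
  isLink : G.IsLink e tail head

instance {α β : Type*} (G : Graph α β) (e : E(G)) : Nonempty (G.Arrow e) := by
  obtain ⟨x, y, h⟩ := (G.edge_mem_iff_exists_isLink e).1 e.2
  exact ⟨⟨x, y, h⟩⟩

instance {α β : Type*} (G : Graph α β) (e : E(G)) : Finite (G.Arrow e) := by
  obtain ⟨x, y, h⟩ := (G.edge_mem_iff_exists_isLink e).1 e.2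
  refine Finite.of_surjective
    (fun b : Bool => if b then (⟨x, y, h⟩ : G.Arrow e) else ⟨y, x, h.symm⟩) ?_
  rintro ⟨a, b, hab⟩
  rcases h.eq_and_eq_or_eq_and_eq hab with ⟨rfl, rfl⟩ | ⟨rfl, rfl⟩
  · exact ⟨true, rfl⟩
  · exact ⟨false, rfl⟩

instance {α β : Type*} (G : Graph α β) (e : E(G)) : MeasurableSpace (G.Arrow e) := ⊤

instance {α β : Type*} (G : Graph α β) (e : E(G)) : MeasurableSingletonClass (G.Arrow e) :=
  ⟨fun _ => trivial⟩

/-- An orientation of `G`: an orientation of each edge. -/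
abbrev Orientation {α β : Type*} (G : Graph α β) : Type _ := (e : E(G)) → G.Arrow e

/-- A sink of an orientation: a vertex that is not the tail of any edge. -/
def Orientation.IsSink {α β : Type*} {G : Graph α β} (o : G.Orientation) (v : α) : Prop :=
  v ∈ V(G) ∧ ∀ e : E(G), (o e).tail ≠ v

/-- A sink-free orientation. -/
def Orientation.IsSinkFree {α β : Type*} {G : Graph α β} (o : G.Orientation) : Prop :=
  ∀ v : α, ¬ o.IsSink v

/-- The sample space: below each edge there is an infinite stack of arrows,
`ω (e, k)` being the arrow of `e` at depth `k`. -/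
abbrev Stacks {α β : Type*} (G : Graph α β) : Type _ := (i : E(G) × ℕ) → G.Arrow i.1

instance {α β : Type*} (G : Graph α β) (i : E(G) × ℕ) :
    IsProbabilityMeasure (uniformOn (Set.univ : Set (G.Arrow i.1))) :=
  isProbabilityMeasure_uniformOn Set.finite_univ Set.univ_nonempty

/-- All arrows in the stacks are independent, each uniform among the orientations of its edge. -/
noncomputable def stackMeasure {α β : Type*} (G : Graph α β) : Measure G.Stacks :=
  Measure.infinitePi fun i : E(G) × ℕ => uniformOn (Set.univ : Set (G.Arrow i.1))

/-- The orientation that is visible on top of the stacks once `f e` arrows of each edge `e`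
have been removed. -/
def Stacks.top {α β : Type*} {G : Graph α β} (ω : G.Stacks) (f : E(G) → ℕ) : G.Orientation :=
  fun e => ω (e, f e)

/-- A rule for choosing the sink to pop. The choice is arbitrary among the present sinks; it may
depend on the time `k`, on the depths `f`, and on the entire content `ω` of the stacks
(hence, in particular, on the whole history). -/
structure ChoiceRule {α β : Type*} (G : Graph α β) where
  choose : G.Stacks → ℕ → (E(G) → ℕ) → α
  isSink : ∀ (ω : G.Stacks) (k : ℕ) (f : E(G) → ℕ),
    ¬ (ω.top f).IsSinkFree → (ω.top f).IsSink (choose ω k f)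

open Classical in
/-- `r.depth ω k e` is the number of arrows of `e` that have been removed by time `k`. As long as
the visible orientation has a sink, the chosen sink is popped: every edge incident to it loses its
top arrow. Nothing happens any more once a sink-free orientation is reached. -/
noncomputable def ChoiceRule.depth {α β : Type*} {G : Graph α β} (r : G.ChoiceRule)
    (ω : G.Stacks) : ℕ → E(G) → ℕ
  | 0 => fun _ => 0
  | k + 1 =>
    if (ω.top (r.depth ω k)).IsSinkFree then r.depth ω k
    else fun e =>
      if G.Inc e (r.choose ω k (r.depth ω k)) then r.depth ω k e + 1 else r.depth ω k e

/-- The orientation at time `k`. -/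
noncomputable def ChoiceRule.state {α β : Type*} {G : Graph α β} (r : G.ChoiceRule)
    (ω : G.Stacks) (k : ℕ) : G.Orientation :=
  ω.top (r.depth ω k)

/-- The total number (possibly infinite) of times the vertex `v` is popped. -/
noncomputable def ChoiceRule.numPops {α β : Type*} {G : Graph α β} (r : G.ChoiceRule)
    (v : α) (ω : G.Stacks) : ℝ≥0∞ :=
  ({k : ℕ | ¬ (r.state ω k).IsSinkFree ∧ r.choose ω k (r.depth ω k) = v}.encard : ℕ∞)

/-- `G` is the `n`-cycle, `n ≥ 1`: its vertices are `v 0, …, v (n - 1)` and its edges are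
`e 0, …, e (n - 1)`, without repetition, where `e i` joins `v i` to `v (i + 1)`, indices taken
modulo `n`. The `1`-cycle is a vertex with a loop, the `2`-cycle a pair of parallel edges. -/
def IsNCycle {α β : Type*} (G : Graph α β) (n : ℕ) : Prop :=
  1 ≤ n ∧ ∃ (v : ZMod n → α) (e : ZMod n → β),
    Function.Injective v ∧ Function.Injective e ∧ Set.range v = V(G) ∧ Set.range e = E(G) ∧
      ∀ i, G.IsLink (e i) (v i) (v (i + 1))

end Graph

/-! Popping is abelian: a sink stays a sink until it is popped, and pops commute, so no legal
sequence pops a vertex more often than a terminating one (`IsLocal.count_le`). If `H` is a subgraph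
of `G`, the pops of `G` inside `V(H)` form a legal sequence for `H`. Hence a vertex of a cycle `H`
is popped in `G` at most as often as in `H` alone whenever popping `H` terminates, and it suffices
to show that on an `n`-cycle every vertex has expectation exactly `(n-1)/2`.

For the cycle, encode an orientation by signs `x i = ±1` (forward or backward), with sum `S`. Vertex
`i` is a sink iff `x (i-1) = 1` and `x i = -1`; popping it replaces both by fresh signs. The mean
change of `-S²/(2n)` is `-1/n`, and the linear part of `potential` changes on average by `1/n`,
minus `1` if `i = i₀`. So the potential plus the number of pops of `i₀` is a martingale. The
potential is bounded, has initial mean `(n-1)/2` and vanishes on sink-free orientations; boundedness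
gives almost sure termination, and passing to the limit gives the expectation
(`lintegral_canonCount_eq`).

A choice rule need not be measurable. Its counts are therefore compared with those of a canonical
rule that looks only at the visible orientation; the two agree almost surely by the abelian
property. Equality forces a spanning cycle, and any additional edge produces an initial orientation
of positive probability for which `G` needs no pop but the cycle does. -/

namespace Popping

/-! ### The abelian property -/

variable {E V : Type*}

open Classical in
/-- Popping `v` increases the depth of the edges incident to `v`. -/
noncomputable def pop (inc : E → V → Prop) (v : V) (f : E → ℕ) : E → ℕ :=
  fun e => if inc e v then f e + 1 else f e

/-- The depths after popping the vertices of a list. -/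
noncomputable def run (inc : E → V → Prop) : (E → ℕ) → List V → E → ℕ
  | f, [] => f
  | f, v :: L => run inc (pop inc v f) L

/-- Every vertex of the list is a sink at the moment when it is popped. -/
def Legal (inc : E → V → Prop) (sink : (E → ℕ) → V → Prop) : (E → ℕ) → List V → Prop
  | _, [] => True
  | f, v :: L => sink f v ∧ Legal inc sink (pop inc v f) L

/-- Being a sink depends only on the incident edges, and distinct sinks share no edge. -/
structure IsLocal (inc : E → V → Prop) (sink : (E → ℕ) → V → Prop) : Prop where
  congr : ∀ f g v, (∀ e, inc e v → f e = g e) → sink f v → sink g v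
  eq_of_inc : ∀ f u v e, sink f u → sink f v → inc e u → inc e v → u = v

variable {inc : E → V → Prop} {sink : (E → ℕ) → V → Prop}

lemma pop_comm (u v : V) (f : E → ℕ) : pop inc u (pop inc v f) = pop inc v (pop inc u f) := by
  funext e
  simp only [pop]
  split_ifs <;> rfl

lemma IsLocal.sink_pop (h : IsLocal inc sink) {f : E → ℕ} {u v : V} (hu : sink f u)
    (hv : sink f v) (huv : u ≠ v) : sink (pop inc u f) v := by
  refine h.congr f _ v (fun e he => ?_) hv
  have : ¬ inc e u := fun he' => huv (h.eq_of_inc f u v e hu hv he' he)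
  simp [pop, this]

lemma run_append (f : E → ℕ) (A B : List V) :
    run inc f (A ++ B) = run inc (run inc f A) B := by
  induction A generalizing f with
  | nil => rfl
  | cons a A ih => exact ih _

lemma legal_append (f : E → ℕ) (A B : List V) :
    Legal inc sink f (A ++ B) ↔ Legal inc sink f A ∧ Legal inc sink (run inc f A) B := by
  induction A generalizing f with
  | nil => simp [Legal, run]
  | cons a A ih => simp [Legal, run, ih, and_assoc]

/-- Popping other sinks does not touch the edges at `v`, so the first pop of `v` can be exchanged
step by step with its predecessors. -/
lemma IsLocal.move_front (h : IsLocal inc sink) {v : V} {A B : List V} {f : E → ℕ}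
    (hv : sink f v) (hL : Legal inc sink f (A ++ v :: B)) (hA : v ∉ A) :
    Legal inc sink (pop inc v f) (A ++ B) ∧
      run inc (pop inc v f) (A ++ B) = run inc f (A ++ v :: B) := by
  induction A generalizing f with
  | nil => exact ⟨hL.2, rfl⟩
  | cons a A ih =>
    have hav : a ≠ v := fun h => hA (h ▸ List.mem_cons_self)
    obtain ⟨ha, hL⟩ := hL
    obtain ⟨h1, h2⟩ := ih (h.sink_pop ha hv hav) hL (fun h => hA (List.mem_cons_of_mem _ h))
    rw [pop_comm] at h1 h2
    exact ⟨⟨h.sink_pop hv ha hav.symm, h1⟩, h2⟩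

lemma IsLocal.mem_of_terminal (h : IsLocal inc sink) {v : V} {L : List V} {f : E → ℕ}
    (hv : sink f v) (hL : Legal inc sink f L) (hT : ∀ u, ¬ sink (run inc f L) u) : v ∈ L := by
  induction L generalizing f with
  | nil => exact absurd hv (hT v)
  | cons a L ih =>
    by_cases hav : a = v
    · simp [hav]
    · exact List.mem_cons_of_mem _ (ih (h.sink_pop hL.1 hv hav) hL.2 hT)

/-- The abelian property: a legal sequence of pops pops no vertex more often than a terminating
legal sequence does. -/
lemma IsLocal.count_le [DecidableEq V] (h : IsLocal inc sink) {L L' : List V} {f : E → ℕ}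
    (hL : Legal inc sink f L) (hT : ∀ u, ¬ sink (run inc f L) u) (hL' : Legal inc sink f L')
    (u : V) : L'.count u ≤ L.count u := by
  induction L' generalizing f L with
  | nil => simp
  | cons v L' ih =>
    -- The first sink of `L'` must occur in `L`; its first occurrence there is moved to the front
    -- and cancelled.
    obtain ⟨A, B, rfl, hA⟩ := List.eq_append_cons_of_mem (h.mem_of_terminal hL'.1 hL hT)
    obtain ⟨h1, h2⟩ := h.move_front hL'.1 hL hA
    have := ih h1 (h2 ▸ hT) hL'.2
    simp only [List.count_append, List.count_cons] at this ⊢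
    omega

/-! ### Popping processes driven by a choice of sinks -/

open Classical in
/-- The depths at time `k` when the sinks to pop are chosen by `c`. -/
noncomputable def depthSeq (inc : E → V → Prop) (sink : (E → ℕ) → V → Prop)
    (c : ℕ → (E → ℕ) → V) : ℕ → E → ℕ
  | 0 => fun _ => 0
  | k + 1 =>
    if ∃ v, sink (depthSeq inc sink c k) v then
      pop inc (c k (depthSeq inc sink c k)) (depthSeq inc sink c k)
    else depthSeq inc sink c k

/-- The vertex `v` is popped at time `k`. -/
def Popped (inc : E → V → Prop) (sink : (E → ℕ) → V → Prop) (c : ℕ → (E → ℕ) → V) (k : ℕ)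
    (v : V) : Prop :=
  (∃ u, sink (depthSeq inc sink c k) u) ∧ c k (depthSeq inc sink c k) = v

/-- The number of times at which `v` is popped. -/
noncomputable def popCount (inc : E → V → Prop) (sink : (E → ℕ) → V → Prop)
    (c : ℕ → (E → ℕ) → V) (v : V) : ℝ≥0∞ :=
  ({k : ℕ | Popped inc sink c k v}.encard : ℕ∞)

open Classical in
/-- The vertices popped before time `k`. -/
noncomputable def popList (inc : E → V → Prop) (sink : (E → ℕ) → V → Prop)
    (c : ℕ → (E → ℕ) → V) : ℕ → List V
  | 0 => []
  | k + 1 =>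
    if ∃ v, sink (depthSeq inc sink c k) v then
      popList inc sink c k ++ [c k (depthSeq inc sink c k)]
    else popList inc sink c k

/-- The choice `c` always picks a sink if there is one. -/
def Valid (sink : (E → ℕ) → V → Prop) (c : ℕ → (E → ℕ) → V) : Prop :=
  ∀ k f, (∃ v, sink f v) → sink f (c k f)

/-- A sink-free configuration is reached. -/
def Terminates (inc : E → V → Prop) (sink : (E → ℕ) → V → Prop) (c : ℕ → (E → ℕ) → V) : Prop :=
  ∃ k, ∀ v, ¬ sink (depthSeq inc sink c k) v

variable {c : ℕ → (E → ℕ) → V}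

lemma run_popList (k : ℕ) :
    run inc (fun _ => 0) (popList inc sink c k) = depthSeq inc sink c k := by
  induction k with
  | zero => rfl
  | succ k ih =>
    rw [popList, depthSeq]
    split_ifs
    · rw [run_append, ih]; rfl
    · exact ih

lemma legal_popList (hc : Valid sink c) (k : ℕ) :
    Legal inc sink (fun _ => 0) (popList inc sink c k) := by
  induction k with
  | zero => trivial
  | succ k ih =>
    rw [popList]
    split_ifs with hs
    · rw [legal_append, run_popList]
      exact ⟨ih, hc k _ hs, trivial⟩
    · exact ih

lemma popCount_eq_tsum (v : V) :
    popCount inc sink c v = ∑' k, {k : ℕ | Popped inc sink c k v}.indicator 1 k := by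
  rw [popCount, ← ENNReal.tsum_set_one, ← tsum_subtype]
  rfl

open Classical in
lemma sum_popped_eq_count (v : V) (k : ℕ) :
    ∑ j ∈ Finset.range k, {j : ℕ | Popped inc sink c j v}.indicator (1 : ℕ → ℝ≥0∞) j =
      ((popList inc sink c k).count v : ℕ) := by
  induction k with
  | zero => simp [popList]
  | succ k ih =>
    rw [Finset.sum_range_succ, ih, popList]
    by_cases hs : ∃ u, sink (depthSeq inc sink c k) u
    · by_cases hv : c k (depthSeq inc sink c k) = v
      · simp [Popped, hs, hv]
      · simp [Popped, hs, hv]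
    · simp [Popped, hs]

open Classical in
lemma popCount_eq_iSup (v : V) :
    popCount inc sink c v = ⨆ k, (((popList inc sink c k).count v : ℕ) : ℝ≥0∞) := by
  rw [popCount_eq_tsum, ENNReal.tsum_eq_iSup_nat]
  simp_rw [sum_popped_eq_count]

/-- Without termination every time belongs to a pop, and finitely many finite sets of times cannot
cover `ℕ`. -/
lemma terminates_of_popCount_ne_top {W : Set V} (hW : W.Finite) (hs : ∀ f v, sink f v → v ∈ W)
    (hc : Valid sink c) (h : ∀ v ∈ W, popCount inc sink c v ≠ ⊤) : Terminates inc sink c := by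
  by_contra hT
  simp only [Terminates, not_exists, not_forall, not_not] at hT
  have hfin : (⋃ v ∈ W, {k : ℕ | Popped inc sink c k v}).Finite := by
    refine hW.biUnion fun v hv => ?_
    have := h v hv
    rw [popCount, Ne, ENat.toENNReal_eq_top, Set.encard_eq_top_iff] at this
    exact Set.not_infinite.1 this
  refine Set.infinite_univ (hfin.subset fun k _ => ?_)
  simp only [Set.mem_iUnion]
  exact ⟨_, hs _ _ (hc k _ (hT k)), hT k, rfl⟩

/-! ### Comparison with a subsystem -/

section Restrict

variable {inc' : E → V → Prop} {sink' : (E → ℕ) → V → Prop} {c' : ℕ → (E → ℕ) → V}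

/-- Restricting a system to a set `W` of vertices and a set `F` of edges with both ends in `W`. -/
structure IsRestriction (inc inc' : E → V → Prop) (sink sink' : (E → ℕ) → V → Prop) (W : Set V)
    (F : Set E) : Prop where
  sink : ∀ f g v, v ∈ W → (∀ e ∈ F, f e = g e) → sink f v → sink' g v
  inc_iff : ∀ e ∈ F, ∀ v ∈ W, (inc e v ↔ inc' e v)
  not_inc : ∀ e ∈ F, ∀ v ∉ W, ¬ inc e v

-- Pops outside `W` leave the edges of `F` alone, so the subsystem does not notice them.
open Classical in
lemma IsRestriction.legal_filter {W : Set V} {F : Set E}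
    (h : IsRestriction inc inc' sink sink' W F) {L : List V} {f g : E → ℕ}
    (hfg : ∀ e ∈ F, f e = g e) (hL : Legal inc sink f L) :
    Legal inc' sink' g (L.filter (· ∈ W)) := by
  induction L generalizing f g with
  | nil => trivial
  | cons v L ih =>
    by_cases hv : v ∈ W
    · rw [List.filter_cons_of_pos (by simpa using hv)]
      refine ⟨h.sink f g v hv hfg hL.1, ih (fun e he => ?_) hL.2⟩
      simp [pop, h.inc_iff e he v hv, hfg e he]
    · rw [List.filter_cons_of_neg (by simpa using hv)]
      refine ih (fun e he => ?_) hL.2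
      simp [pop, h.not_inc e he v hv, hfg e he]

/-- Only the smaller process has to terminate. Applied to a system as a restriction of itself, this
also compares two choices of sinks. -/
lemma IsRestriction.popCount_le {W : Set V} {F : Set E}
    (h : IsRestriction inc inc' sink sink' W F) (hl : IsLocal inc' sink') (hc : Valid sink c)
    (hc' : Valid sink' c') (hT : Terminates inc' sink' c') {v : V} (hv : v ∈ W) :
    popCount inc sink c v ≤ popCount inc' sink' c' v := by
  classical
  obtain ⟨N, hN⟩ := hT
  rw [popCount_eq_iSup, popCount_eq_iSup]
  refine iSup_le fun k => le_iSup_of_le N ?_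
  have := hl.count_le (legal_popList hc' N) (by rwa [run_popList])
    (h.legal_filter (fun _ _ => rfl) (legal_popList hc k)) v
  rw [List.count_filter (by simpa using hv)] at this
  exact_mod_cast this

end Restrict

lemma one_le_popCount (hl : IsLocal inc sink) (hc : Valid sink c) (hT : Terminates inc sink c)
    {v : V} (hv : sink (fun _ => 0) v) : 1 ≤ popCount inc sink c v := by
  classical
  obtain ⟨N, hN⟩ := hT
  rw [popCount_eq_iSup]
  refine le_iSup_of_le N ?_
  have := hl.count_le (L' := [v]) (legal_popList hc N) (by rwa [run_popList]) ⟨hv, trivial⟩ v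
  rw [List.count_singleton_self] at this
  exact_mod_cast this

end Popping

/-! ### Sink popping on graphs and the canonical measurable choice -/

namespace Graph

open Popping

variable {α β : Type*} {G H : Graph α β}

/-- The incidence relation of `H`, on the edges of `G`. -/
def subInc (G H : Graph α β) (e : E(G)) (v : α) : Prop := H.Inc e v

/-- The sinks of the restriction to `H` of an orientation of `G`. -/
def Orientation.SubSink (H : Graph α β) (o : G.Orientation) (v : α) : Prop :=
  v ∈ V(H) ∧ ∀ e : E(G), H.Inc e v → (o e).tail ≠ v

/-- The sinks of the restriction to `H` of the visible orientation. -/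
def Stacks.SubSink (H : Graph α β) (ω : G.Stacks) (f : E(G) → ℕ) (v : α) : Prop :=
  (ω.top f).SubSink H v

lemma Arrow.tail_or_head {e : E(G)} (a : G.Arrow e) {x y : α} (h : G.IsLink e x y) :
    a.tail = x ∧ a.head = y ∨ a.tail = y ∧ a.head = x :=
  a.isLink.eq_and_eq_or_eq_and_eq h

lemma isLocal_subSink (hHG : H ≤ G) (ω : G.Stacks) :
    IsLocal (subInc G H) (ω.SubSink H) where
  congr f g v hfg h := by
    refine ⟨h.1, fun e he => ?_⟩
    have := h.2 e he
    simp only [Stacks.top] at this ⊢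
    rwa [← hfg e he]
  eq_of_inc f u v e hu hv heu hev := by
    by_contra huv
    obtain ⟨w, hw⟩ := id heu
    have hvw : v = w := (hev.eq_or_eq_of_isLink hw).resolve_left (Ne.symm huv)
    subst hvw
    rcases Arrow.tail_or_head (ω.top f e) (hw.mono hHG) with h | h
    · exact hu.2 e heu h.1
    · exact hv.2 e hev h.1

lemma isRestriction_subSink (hHG : H ≤ G) (ω : G.Stacks) :
    IsRestriction (subInc G G) (subInc G H) (ω.SubSink G) (ω.SubSink H) V(H)
      {e | e.1 ∈ E(H)} where
  sink f g v hv hfg h := by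
    refine ⟨hv, fun e he => ?_⟩
    have := h.2 e (he.mono hHG)
    simp only [Stacks.top] at this ⊢
    rwa [← hfg e he.edge_mem]
  inc_iff e he v _ := (IsSubgraph.inc_congr hHG he).symm
  not_inc e he v hv h := hv ((IsSubgraph.inc_congr hHG he).2 h).vertex_mem

lemma Orientation.isSink_iff (o : G.Orientation) (v : α) : o.IsSink v ↔ o.SubSink G v := by
  refine and_congr_right fun _ => forall_congr' fun e => ⟨fun h _ => h, fun h h' => ?_⟩
  exact h (h' ▸ (o e).isLink.inc_left) h'

lemma Orientation.not_isSinkFree_iff (o : G.Orientation) :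
    ¬ o.IsSinkFree ↔ ∃ v, o.SubSink G v := by
  simp [Orientation.IsSinkFree, Orientation.isSink_iff]

lemma ChoiceRule.valid (r : G.ChoiceRule) (ω : G.Stacks) :
    Valid (ω.SubSink G) (r.choose ω) := fun k f h =>
  (Orientation.isSink_iff _ _).1 (r.isSink ω k f ((Orientation.not_isSinkFree_iff _).2 h))

lemma ChoiceRule.depth_eq (r : G.ChoiceRule) (ω : G.Stacks) (k : ℕ) :
    r.depth ω k = depthSeq (subInc G G) (ω.SubSink G) (r.choose ω) k := by
  induction k with
  | zero => rfl
  | succ k ih =>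
    rw [ChoiceRule.depth, depthSeq, ← ih]
    by_cases h : (ω.top (r.depth ω k)).IsSinkFree
    · rw [if_pos h, if_neg]
      exact fun h' => (Orientation.not_isSinkFree_iff _).2 h' h
    · have h' : ∃ v, ω.SubSink G (r.depth ω k) v := (Orientation.not_isSinkFree_iff _).1 h
      rw [if_neg h, if_pos h']
      rfl

lemma ChoiceRule.numPops_eq (r : G.ChoiceRule) (v : α) (ω : G.Stacks) :
    r.numPops v ω = popCount (subInc G G) (ω.SubSink G) (r.choose ω) v := by
  simp only [ChoiceRule.numPops, popCount, Popped, ChoiceRule.state, r.depth_eq,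
    Orientation.not_isSinkFree_iff]
  rfl

lemma measurable_top {D : G.Stacks → E(G) → ℕ} (hD : Measurable D) :
    Measurable fun ω : G.Stacks => ω.top (D ω) := by
  refine measurable_pi_lambda _ fun e => ?_
  have h : Measurable (β := G.Arrow e) fun p : G.Stacks × ℕ => p.1 (e, p.2) :=
    by
    refine measurable_from_prod_countable_left fun n => ?_
    exact (measurable_pi_apply (e, n) : Measurable fun ω : G.Stacks => ω (e, n))
  exact h.comp (measurable_id.prodMk ((measurable_pi_apply e).comp hD))

/-- A choice of sinks of `H` that depends on the visible orientation only. -/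
noncomputable def canonChoice [Nonempty α] (H : Graph α β) (ω : G.Stacks) (_ : ℕ)
    (f : E(G) → ℕ) : α :=
  Classical.epsilon (ω.SubSink H f)

/-- The depths at time `k` for the canonical choice. -/
noncomputable def canonDepth [Nonempty α] (H : Graph α β) (ω : G.Stacks) (k : ℕ) : E(G) → ℕ :=
  depthSeq (subInc G H) (ω.SubSink H) (canonChoice H ω) k

/-- The number of times `v` is popped for the canonical choice. -/
noncomputable def canonCount [Nonempty α] (H : Graph α β) (v : α) (ω : G.Stacks) : ℝ≥0∞ :=
  popCount (subInc G H) (ω.SubSink H) (canonChoice H ω) v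

variable [Nonempty α]

lemma valid_canonChoice (H : Graph α β) (ω : G.Stacks) :
    Valid (ω.SubSink H) (canonChoice H ω) := fun _ _ h => Classical.epsilon_spec h

/-- The set of stacks for which `v` is popped at time `k`. -/
def canonPopped (G H : Graph α β) (k : ℕ) (v : α) : Set G.Stacks :=
  {ω | Popped (subInc G H) (ω.SubSink H) (canonChoice H ω) k v}

/-- The depths after one canonical step. -/
noncomputable def canonStep (H : Graph α β) (p : (E(G) → ℕ) × G.Orientation) : E(G) → ℕ :=
  open Classical in
  if ∃ v, p.2.SubSink H v then pop (subInc G H) (Classical.epsilon (p.2.SubSink H)) p.1 else p.1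

lemma canonDepth_succ (ω : G.Stacks) (k : ℕ) :
    canonDepth H ω (k + 1) = canonStep H (canonDepth H ω k, ω.top (canonDepth H ω k)) := rfl

lemma mem_canonPopped {ω : G.Stacks} {k : ℕ} {v : α} :
    ω ∈ canonPopped G H k v ↔ (∃ u, (ω.top (canonDepth H ω k)).SubSink H u) ∧
      Classical.epsilon ((ω.top (canonDepth H ω k)).SubSink H) = v := Iff.rfl

/-- The canonical step is a function on a countable discrete space, hence measurable whatever
`epsilon` selects. -/
lemma measurable_canonDepth [Finite E(G)] (H : Graph α β) (k : ℕ) :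
    Measurable fun ω : G.Stacks => canonDepth H ω k := by
  induction k with
  | zero => exact measurable_const
  | succ k ih =>
    simp_rw [canonDepth_succ]
    exact (measurable_of_countable (canonStep H)).comp (ih.prodMk (measurable_top ih))

lemma measurableSet_canonPopped [Finite E(G)] (H : Graph α β) (k : ℕ) (v : α) :
    MeasurableSet (canonPopped G H k v) :=
  measurable_top (measurable_canonDepth H k) (Set.to_countable
    {o : G.Orientation | (∃ u, o.SubSink H u) ∧ Classical.epsilon (o.SubSink H) = v}).measurableSet

lemma canonCount_eq_tsum (v : α) (ω : G.Stacks) :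
    canonCount H v ω = ∑' k, (canonPopped G H k v).indicator 1 ω :=
  popCount_eq_tsum v

lemma measurable_canonCount [Finite E(G)] (H : Graph α β) (v : α) :
    Measurable fun ω : G.Stacks => canonCount H v ω := by
  simp_rw [canonCount_eq_tsum]
  exact Measurable.tsum fun k =>
    measurable_one.indicator (measurableSet_canonPopped H k v)

/-- The canonical process reaches an orientation without sinks of `H`. -/
def CanonTerminates (H : Graph α β) (ω : G.Stacks) : Prop :=
  Terminates (subInc G H) (ω.SubSink H) (canonChoice H ω)

lemma numPops_le_canonCount (hHG : H ≤ G) (r : G.ChoiceRule) {ω : G.Stacks}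
    (hT : CanonTerminates H ω) {v : α} (hv : v ∈ V(H)) :
    r.numPops v ω ≤ canonCount H v ω := by
  rw [r.numPops_eq]
  exact (isRestriction_subSink hHG ω).popCount_le (isLocal_subSink hHG ω) (r.valid ω)
    (valid_canonChoice H ω) hT hv

lemma canonCount_self_le (hHG : H ≤ G) {ω : G.Stacks}
    (hT : CanonTerminates H ω) {v : α} (hv : v ∈ V(H)) :
    canonCount G v ω ≤ canonCount H v ω :=
  (isRestriction_subSink hHG ω).popCount_le (isLocal_subSink hHG ω) (valid_canonChoice G ω)
    (valid_canonChoice H ω) hT hv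

lemma canonTerminates_of_ne_top (hV : V(H).Finite) {ω : G.Stacks}
    (h : ∀ v ∈ V(H), canonCount H v ω ≠ ⊤) : CanonTerminates H ω :=
  terminates_of_popCount_ne_top hV (fun _ _ h => h.1) (valid_canonChoice H ω) h

/-- Finite canonical counts bound those of `r`, so `r` terminates as well and the comparison can be
run in both directions. -/
lemma numPops_eq_canonCount (hV : V(G).Finite) (r : G.ChoiceRule) {ω : G.Stacks}
    (hT : CanonTerminates G ω) {v : α} (hv : v ∈ V(G)) (hfin : ∀ v ∈ V(G), canonCount G v ω ≠ ⊤) :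
    r.numPops v ω = canonCount G v ω := by
  refine le_antisymm (numPops_le_canonCount le_rfl r hT hv) ?_
  have hr : Terminates (subInc G G) (ω.SubSink G) (r.choose ω) := by
    refine terminates_of_popCount_ne_top hV (fun _ _ h => h.1) (r.valid ω) fun u hu => ?_
    rw [← r.numPops_eq]
    exact ne_top_of_le_ne_top (hfin u hu) (numPops_le_canonCount le_rfl r hT hu)
  rw [r.numPops_eq]
  exact (isRestriction_subSink le_rfl ω).popCount_le (isLocal_subSink le_rfl ω)
    (valid_canonChoice G ω) (r.valid ω) hr hv

end Graph

/-! ### Reversing one arrow, as a substitute for conditioning -/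

namespace Graph

open Popping

variable {α β : Type*} {G H : Graph α β}

/-- The opposite orientation of an edge. -/
def Arrow.reverse {e : E(G)} (a : G.Arrow e) : G.Arrow e := ⟨a.head, a.tail, a.isLink.symm⟩

lemma Arrow.reverse_involutive {e : E(G)} : Function.Involutive (Arrow.reverse (e := e)) :=
  fun _ => rfl

lemma map_reverse_uniformOn (e : E(G)) :
    (uniformOn (Set.univ : Set (G.Arrow e))).map Arrow.reverse = uniformOn Set.univ := by
  have := Fintype.ofFinite (G.Arrow e)
  ext s _
  rw [Measure.map_apply (measurable_of_countable _) (Set.toFinite s).measurableSet,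
    uniformOn_univ, uniformOn_univ]
  congr 1
  rw [← Arrow.reverse_involutive.image_eq_preimage_symm,
    Measure.count_injective_image Arrow.reverse_involutive.injective]

open Classical in
/-- Reversal of a single arrow of the stacks. -/
noncomputable def Stacks.flip (i : E(G) × ℕ) (ω : G.Stacks) : G.Stacks :=
  fun j => if j = i then (ω j).reverse else ω j

lemma Stacks.flip_same (i : E(G) × ℕ) (ω : G.Stacks) : ω.flip i i = (ω i).reverse := by
  simp [Stacks.flip]

lemma Stacks.flip_of_ne {i j : E(G) × ℕ} (h : j ≠ i) (ω : G.Stacks) : ω.flip i j = ω j := by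
  simp [Stacks.flip, h]

lemma Stacks.flip_flip (i : E(G) × ℕ) (ω : G.Stacks) : (ω.flip i).flip i = ω := by
  funext j
  by_cases h : j = i
  · subst h
    simp [Stacks.flip_same, Arrow.reverse]
  · simp [Stacks.flip_of_ne h]

lemma measurePreserving_flip (i : E(G) × ℕ) :
    MeasurePreserving (Stacks.flip i) G.stackMeasure G.stackMeasure := by
  classical
  let F : (j : E(G) × ℕ) → G.Arrow j.1 → G.Arrow j.1 :=
    fun j => if j = i then Arrow.reverse else id
  have hF : Stacks.flip i = fun (ω : G.Stacks) j => F j (ω j) := by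
    funext ω j
    by_cases h : j = i <;> simp [Stacks.flip, F, h]
  have hm : ∀ j, Measurable (F j) := fun j => measurable_of_countable _
  refine ⟨?_, ?_⟩
  · rw [hF]
    exact measurable_pi_lambda _ fun j => (hm j).comp (measurable_pi_apply j)
  · rw [hF, stackMeasure, Measure.infinitePi_map_pi _ hm]
    congr 1
    funext j
    by_cases h : j = i
    · simp only [F, if_pos h]
      exact map_reverse_uniformOn j.1
    · simp [F, if_neg h]

instance : IsProbabilityMeasure G.stackMeasure := by
  unfold stackMeasure
  infer_instance

lemma integral_eq_zero_of_flip {F : G.Stacks → ℝ} (hF : Integrable F G.stackMeasure)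
    (i : E(G) × ℕ) (h : ∀ ω, F (ω.flip i) = -F ω) : ∫ ω, F ω ∂G.stackMeasure = 0 := by
  have hmp := measurePreserving_flip i
  have h1 : ∫ ω, F ω ∂G.stackMeasure = ∫ ω, F (ω.flip i) ∂G.stackMeasure := by
    conv_lhs => rw [← hmp.map_eq]
    refine integral_map hmp.measurable.aemeasurable ?_
    rw [hmp.map_eq]
    exact hF.aestronglyMeasurable
  simp only [h, integral_neg] at h1
  linarith

lemma Stacks.top_flip {e : E(G)} {m : ℕ} {f : E(G) → ℕ} (hf : f e ≠ m) (ω : G.Stacks) :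
    (ω.flip (e, m)).top f = ω.top f := by
  funext e'
  refine Stacks.flip_of_ne (fun h => hf ?_) ω
  obtain ⟨rfl, h⟩ := Prod.ext_iff.1 h
  exact h

lemma measurable_top_const (f : E(G) → ℕ) : Measurable fun ω : G.Stacks => ω.top f :=
  measurable_top measurable_const

lemma integrable_comp_of_finite {γ : Type*} [Finite γ] [MeasurableSpace γ]
    [MeasurableSingletonClass γ] {Z : G.Stacks → γ} (hZ : Measurable Z) (p : γ → ℝ) :
    Integrable (fun ω => p (Z ω)) G.stackMeasure := by
  have := Measure.isProbabilityMeasure_map (μ := G.stackMeasure) hZ.aemeasurable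
  exact (Integrable.of_finite (μ := G.stackMeasure.map Z) (f := p)).comp_measurable hZ

section Canon

variable [Nonempty α]

lemma canonDepth_le_succ (ω : G.Stacks) (k : ℕ) (e : E(G)) :
    canonDepth H ω k e ≤ canonDepth H ω (k + 1) e := by
  rw [canonDepth_succ, canonStep]
  split_ifs
  · simp only [pop]
    split_ifs <;> omega
  · exact le_rfl

lemma canonDepth_le (ω : G.Stacks) (k : ℕ) (e : E(G)) : canonDepth H ω k e ≤ k := by
  induction k with
  | zero => exact le_rfl
  | succ k ih =>
    rw [canonDepth_succ, canonStep]
    split_ifs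
    · simp only [pop]
      split_ifs <;> omega
    · exact Nat.le_succ_of_le ih

/-- An arrow below the currently visible one has never been looked at. -/
lemma canonDepth_flip {ω : G.Stacks} {k m : ℕ} {e : E(G)} (h : canonDepth H ω k e < m) :
    canonDepth H (ω.flip (e, m)) k = canonDepth H ω k := by
  induction k with
  | zero => rfl
  | succ k ih =>
    have hk : canonDepth H ω k e < m := (canonDepth_le_succ ω k e).trans_lt h
    rw [canonDepth_succ, canonDepth_succ, ih hk, Stacks.top_flip hk.ne]

/-- At time `k` the depths are `f`, and `v` is popped. -/
def canonEvent (G H : Graph α β) (k : ℕ) (f : E(G) → ℕ) (v : α) : Set G.Stacks :=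
  {ω | canonDepth H ω k = f} ∩ canonPopped G H k v

lemma canonEvent_flip_of_mem {ω : G.Stacks} {k m : ℕ} {f : E(G) → ℕ} {v : α} {e : E(G)}
    (h : f e < m) (hω : ω ∈ canonEvent G H k f v) : ω.flip (e, m) ∈ canonEvent G H k f v := by
  obtain ⟨h1, h2⟩ := hω
  have h1' : canonDepth H ω k = f := h1
  have hk : canonDepth H ω k e < m := by rwa [h1']
  have hd := canonDepth_flip hk
  refine ⟨hd.trans h1', ?_⟩
  rw [mem_canonPopped] at h2 ⊢
  rwa [hd, Stacks.top_flip hk.ne]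

lemma canonEvent_flip {ω : G.Stacks} {k m : ℕ} {f : E(G) → ℕ} {v : α} {e : E(G)}
    (h : f e < m) : ω.flip (e, m) ∈ canonEvent G H k f v ↔ ω ∈ canonEvent G H k f v := by
  refine ⟨fun h' => ?_, canonEvent_flip_of_mem h⟩
  have := canonEvent_flip_of_mem h h'
  rwa [Stacks.flip_flip] at this

lemma measurableSet_canonEvent [Finite E(G)] (k : ℕ) (f : E(G) → ℕ) (v : α) :
    MeasurableSet (canonEvent G H k f v) :=
  (measurable_canonDepth H k (measurableSet_singleton f)).inter (measurableSet_canonPopped H k v)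

/-- Averaging over an arrow that has not been uncovered yet. -/
lemma integral_canonEvent_eq_zero [Finite E(G)] (k : ℕ) (f : E(G) → ℕ) (v : α) (e : E(G))
    (q : G.Orientation → G.Orientation → ℝ)
    (hq : ∀ ω : G.Stacks, q (ω.top f) ((ω.flip (e, f e + 1)).top (f + 1)) =
      -q (ω.top f) (ω.top (f + 1))) :
    ∫ ω, (canonEvent G H k f v).indicator (fun ω => q (ω.top f) (ω.top (f + 1))) ω
      ∂G.stackMeasure = 0 := by
  refine integral_eq_zero_of_flip ?_ (e, f e + 1) fun ω => ?_
  · exact (integrable_comp_of_finite ((measurable_top_const f).prodMk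
      (measurable_top_const (f + 1))) fun p => q p.1 p.2).indicator (measurableSet_canonEvent k f v)
  · by_cases h : ω ∈ canonEvent G H k f v
    · rw [Set.indicator_of_mem h, Set.indicator_of_mem ((canonEvent_flip (by omega)).2 h),
        Stacks.top_flip (by omega), hq]
    · rw [Set.indicator_of_notMem h,
        Set.indicator_of_notMem (fun h' => h ((canonEvent_flip (by omega)).1 h')), neg_zero]

end Canon

end Graph

/-! ### The potential on a cycle -/

namespace CyclePotential

variable {n : ℕ} [NeZero n]

/-- The linear coefficients of the potential. -/
noncomputable def coeff (i₀ i : ZMod n) : ℝ :=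
  ((i - i₀).val : ℝ) / n - ((n : ℝ) - 1) / (2 * n)

/-- The potential of a sign vector on the edges of a cycle, for counting the pops of the vertex
`i₀`. -/
noncomputable def potential (i₀ : ZMod n) (x : ZMod n → ℝ) : ℝ :=
  n / 2 - (∑ i, x i) ^ 2 / (2 * n) + ∑ i, coeff i₀ i * x i

lemma sum_val : ∑ i : ZMod n, (i.val : ℝ) = n * (n - 1) / 2 := by
  obtain ⟨m, rfl⟩ := Nat.exists_eq_succ_of_ne_zero (NeZero.ne n)
  have h : ∑ i : ZMod (m + 1), (i.val : ℝ) = ∑ i ∈ Finset.range (m + 1), (i : ℝ) :=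
    Fin.sum_univ_eq_sum_range (fun i => (i : ℝ)) (m + 1)
  refine h.trans ?_
  have := Finset.sum_range_id_mul_two (m + 1)
  rw [Nat.add_sub_cancel] at this
  have h2 := congrArg (Nat.cast : ℕ → ℝ) this
  push_cast at h2 ⊢
  linarith

lemma sum_coeff (i₀ : ZMod n) : ∑ i, coeff i₀ i = 0 := by
  have hn : (n : ℝ) ≠ 0 := Nat.cast_ne_zero.2 (NeZero.ne n)
  have h : ∑ i : ZMod n, ((i - i₀).val : ℝ) = ∑ i : ZMod n, (i.val : ℝ) :=
    (Equiv.subRight i₀).sum_comp fun i => (i.val : ℝ)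
  simp only [coeff, Finset.sum_sub_distrib, ← Finset.sum_div, h, sum_val, Finset.sum_const,
    Finset.card_univ, ZMod.card, nsmul_eq_mul]
  field_simp
  ring

lemma val_sub_val_sub_one (hn : 2 ≤ n) (j : ZMod n) :
    (j.val : ℝ) - ((j - 1).val : ℝ) = 1 - if j = 0 then (n : ℝ) else 0 := by
  have : Fact (1 < n) := ⟨hn⟩
  by_cases hj : j = 0
  · subst hj
    obtain ⟨m, rfl⟩ := Nat.exists_eq_succ_of_ne_zero (NeZero.ne n)
    simp [ZMod.val_neg_one]
  · have h1 : (1 : ZMod n).val ≤ j.val := by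
      rw [ZMod.val_one]
      exact Nat.one_le_iff_ne_zero.2 fun h => hj ((ZMod.val_eq_zero j).1 h)
    rw [ZMod.val_sub h1, Nat.cast_sub h1, ZMod.val_one]
    simp [hj]

/-- The coefficients rise by `1/n` around the cycle and drop back at `i₀`. The slope compensates the
drift of the quadratic term; the drop counts the pops of `i₀`. -/
lemma coeff_sub_coeff (hn : 2 ≤ n) (i₀ i : ZMod n) :
    coeff i₀ i - coeff i₀ (i - 1) = 1 / n - if i = i₀ then 1 else 0 := by
  have hn' : (n : ℝ) ≠ 0 := Nat.cast_ne_zero.2 (NeZero.ne n)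
  have h := val_sub_val_sub_one hn (i - i₀)
  rw [show i - i₀ - 1 = i - 1 - i₀ by ring] at h
  simp only [sub_eq_zero] at h
  simp only [coeff]
  have h2 : (((i - i₀).val : ℝ) - ((i - 1 - i₀).val : ℝ)) / n = 1 / n - if i = i₀ then 1 else 0 := by
    rw [h]
    split_ifs
    · field_simp
    · simp
  rw [← h2]
  ring

lemma potential_const (i₀ : ZMod n) {x : ZMod n → ℝ} {a : ℝ} (ha : a ^ 2 = 1)
    (hx : ∀ i, x i = a) : potential i₀ x = 0 := by
  have hn : (n : ℝ) ≠ 0 := Nat.cast_ne_zero.2 (NeZero.ne n)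
  simp only [potential, hx, ← Finset.sum_mul, sum_coeff, Finset.sum_const, Finset.card_univ,
    ZMod.card, nsmul_eq_mul]
  rw [mul_pow, ha]
  field_simp
  ring

/-- A sign vector in which no `1` is followed by a `-1` is constant. -/
lemma potential_eq_zero (i₀ : ZMod n) {x : ZMod n → ℝ} (hx : ∀ i, x i = 1 ∨ x i = -1)
    (h : ∀ i, ¬ (x (i - 1) = 1 ∧ x i = -1)) : potential i₀ x = 0 := by
  by_cases h1 : ∃ j, x j = 1
  · obtain ⟨j, hj⟩ := h1
    -- A sign `1` propagates forward around the whole cycle.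
    have key : ∀ m : ℕ, x (j + m) = 1 := by
      intro m
      induction m with
      | zero => simpa using hj
      | succ m ih =>
        refine (hx _).resolve_right fun h' => h (j + (m + 1 : ℕ)) ⟨?_, h'⟩
        rw [← ih]
        congr 1
        push_cast
        ring
    refine potential_const i₀ (a := 1) (by norm_num) fun i => ?_
    have := key (i - j).val
    rwa [ZMod.natCast_val, ZMod.cast_id, add_sub_cancel] at this
  · push Not at h1
    exact potential_const i₀ (a := -1) (by norm_num) fun i => (hx i).resolve_left (h1 i)

/-- The effect of resampling the signs at `i - 1` and `i`. -/
lemma potential_step (hn : 2 ≤ n) (i₀ i : ZMod n) {x x' : ZMod n → ℝ} (h1 : x (i - 1) = 1)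
    (h2 : x i = -1) (hx : ∀ j, j ≠ i - 1 → j ≠ i → x' j = x j) (h1' : x' (i - 1) ^ 2 = 1)
    (h2' : x' i ^ 2 = 1) :
    potential i₀ x' - potential i₀ x + (if i = i₀ then 1 else 0) =
      x' (i - 1) * (coeff i₀ (i - 1) - (∑ j, x j) / n) + x' i * (coeff i₀ i - (∑ j, x j) / n) +
        x' (i - 1) * (-x' i / n) := by
  have hn' : (n : ℝ) ≠ 0 := Nat.cast_ne_zero.2 (NeZero.ne n)
  have hne : i - 1 ≠ i := by
    have : Fact (1 < n) := ⟨hn⟩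
    simp
  have hsum : ∀ c : ZMod n → ℝ, ∑ j, c j * x' j =
      ∑ j, c j * x j + c (i - 1) * (x' (i - 1) - 1) + c i * (x' i + 1) := by
    intro c
    have : ∑ j, (c j * x' j - c j * x j) =
        c (i - 1) * (x' (i - 1) - 1) + c i * (x' i + 1) := by
      rw [Fintype.sum_eq_add (i - 1) i hne]
      · rw [h1, h2]; ring
      · rintro j ⟨hj1, hj2⟩
        rw [hx j hj1 hj2, sub_self]
    rw [Finset.sum_sub_distrib] at this
    linarith
  have hS := hsum fun _ => 1
  simp only [one_mul] at hS
  have hc := coeff_sub_coeff hn i₀ i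
  have hif : (if i = i₀ then (1 : ℝ) else 0) = 1 / n - (coeff i₀ i - coeff i₀ (i - 1)) := by
    rw [hc]; ring
  rw [hif]
  simp only [potential, hsum (coeff i₀), hS]
  generalize ∑ j, x j = S
  generalize ∑ j, coeff i₀ j * x j = T
  generalize x' (i - 1) = y at *
  generalize x' i = z at *
  generalize coeff i₀ (i - 1) = b
  generalize coeff i₀ i = c
  field_simp
  -- The squares of the two fresh signs contribute `-1/n`, cancelling the slope `1/n`; what remains
  -- is multilinear without constant term.
  linear_combination (-1) * h1' - h2'

/-- The potential as a multilinear polynomial in the signs. -/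
lemma potential_eq (i₀ : ZMod n) {x : ZMod n → ℝ} (hx : ∀ i, x i ^ 2 = 1) :
    potential i₀ x = ((n : ℝ) - 1) / 2 +
      ((∑ i, ∑ j, (if i = j then 0 else x i * x j)) * (-1 / (2 * n)) +
        ∑ i, coeff i₀ i * x i) := by
  have hn' : (n : ℝ) ≠ 0 := Nat.cast_ne_zero.2 (NeZero.ne n)
  have : (∑ i, x i) ^ 2 = n + ∑ i, ∑ j, (if i = j then 0 else x i * x j) := by
    rw [sq, Finset.sum_mul_sum, ← sub_eq_iff_eq_add, ← Finset.sum_sub_distrib]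
    have : ∀ i, ∑ j, x i * x j - ∑ j, (if i = j then 0 else x i * x j) = 1 := by
      intro i
      rw [← Finset.sum_sub_distrib, Fintype.sum_eq_single i]
      · simp [← sq, hx]
      · intro j hj
        simp [hj.symm]
    simp [this]
  rw [potential, this]
  field_simp
  ring

end CyclePotential

/-! ### Signs on a cycle and the drift of the energy -/

namespace Popping

variable {E V : Type*} {inc : E → V → Prop} {sink : (E → ℕ) → V → Prop} {c : ℕ → (E → ℕ) → V}

lemma not_sink_of_le {k l : ℕ} (hkl : k ≤ l) (h : ∀ v, ¬ sink (depthSeq inc sink c k) v) :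
    ∀ v, ¬ sink (depthSeq inc sink c l) v := by
  induction l, hkl using Nat.le_induction with
  | base => exact h
  | succ l _ ih =>
    have : ¬ ∃ v, sink (depthSeq inc sink c l) v := not_exists.2 ih
    rwa [depthSeq, if_neg this]

end Popping

namespace Graph

open Popping CyclePotential

variable {α β : Type*} {G H : Graph α β} {n : ℕ}

/-- A labelling of the vertices and edges of a subgraph `H` of `G` that exhibits `H` as a
cycle of length `n ≥ 2`. -/
structure CycleLabelling (G H : Graph α β) (n : ℕ) where
  vert : ZMod n → α
  edge : ZMod n → E(G)
  le : H ≤ G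
  two_le : 2 ≤ n
  vert_injective : Function.Injective vert
  edge_injective : Function.Injective edge
  vert_range : Set.range vert = V(H)
  edge_range : ∀ e : E(G), e.1 ∈ E(H) → ∃ i, e = edge i
  isLink : ∀ i, H.IsLink (edge i) (vert i) (vert (i + 1))

namespace CycleLabelling

variable (C : CycleLabelling G H n)

lemma fact_one_lt (C : CycleLabelling G H n) : Fact (1 < n) := ⟨C.two_le⟩

lemma sub_one_ne (C : CycleLabelling G H n) (i : ZMod n) : i - 1 ≠ i := by
  have := C.fact_one_lt
  simp

lemma vert_mem (i : ZMod n) : C.vert i ∈ V(H) := C.vert_range ▸ ⟨i, rfl⟩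

lemma isLink' (i : ZMod n) : H.IsLink (C.edge (i - 1)) (C.vert (i - 1)) (C.vert i) := by
  simpa using C.isLink (i - 1)

lemma inc_iff (e : E(G)) (i : ZMod n) :
    H.Inc e (C.vert i) ↔ e = C.edge (i - 1) ∨ e = C.edge i := by
  constructor
  · intro h
    obtain ⟨j, rfl⟩ := C.edge_range e h.edge_mem
    rcases h.eq_or_eq_of_isLink (C.isLink j) with h | h
    · exact Or.inr (congrArg _ (C.vert_injective h).symm)
    · left
      rw [C.vert_injective h, add_sub_cancel_right]
  · rintro (rfl | rfl)
    · exact (C.isLink' i).inc_right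
    · exact (C.isLink i).inc_left

open Classical in
/-- The signs of the edges of the cycle: `1` for an edge that points forward. -/
noncomputable def sign (o : G.Orientation) (i : ZMod n) : ℝ :=
  if (o (C.edge i)).tail = C.vert i then 1 else -1

lemma sign_eq (o : G.Orientation) (i : ZMod n) : C.sign o i = 1 ∨ C.sign o i = -1 := by
  unfold sign
  split_ifs <;> simp

lemma sign_sq (o : G.Orientation) (i : ZMod n) : C.sign o i ^ 2 = 1 := by
  rcases C.sign_eq o i with h | h <;> rw [h] <;> norm_num

lemma vert_succ_ne (i : ZMod n) : C.vert (i + 1) ≠ C.vert i := by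
  have := C.fact_one_lt
  exact fun h => by simpa using C.vert_injective h

lemma sign_eq_one_iff (o : G.Orientation) (i : ZMod n) :
    C.sign o i = 1 ↔ (o (C.edge i)).tail ≠ C.vert (i + 1) := by
  unfold sign
  rcases Arrow.tail_or_head (o (C.edge i)) ((C.isLink i).mono C.le) with h | h
  · simp [h.1, (C.vert_succ_ne i).symm]
  · simp only [h.1, (C.vert_succ_ne i)]
    norm_num

lemma sign_eq_neg_one_iff (o : G.Orientation) (i : ZMod n) :
    C.sign o i = -1 ↔ (o (C.edge i)).tail ≠ C.vert i := by
  unfold sign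
  split_ifs with h
  · simp only [h]
    norm_num
  · simp [h]

lemma subSink_iff (o : G.Orientation) (i : ZMod n) :
    o.SubSink H (C.vert i) ↔ C.sign o (i - 1) = 1 ∧ C.sign o i = -1 := by
  rw [sign_eq_one_iff, sign_eq_neg_one_iff, sub_add_cancel]
  constructor
  · intro h
    exact ⟨h.2 _ ((C.inc_iff _ i).2 (Or.inl rfl)), h.2 _ ((C.inc_iff _ i).2 (Or.inr rfl))⟩
  · rintro ⟨h1, h2⟩
    refine ⟨C.vert_mem i, fun e he => ?_⟩
    rcases (C.inc_iff e i).1 he with rfl | rfl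
    · exact h1
    · exact h2

lemma potential_eq_zero_of_not_sink [NeZero n] (i₀ : ZMod n) {o : G.Orientation}
    (h : ∀ v, ¬ o.SubSink H v) : potential i₀ (C.sign o) = 0 :=
  potential_eq_zero i₀ (C.sign_eq o) fun i hi => h _ ((C.subSink_iff o i).2 hi)

lemma sign_flip_same (ω : G.Stacks) (i : ZMod n) (f : E(G) → ℕ) :
    C.sign ((ω.flip (C.edge i, f (C.edge i))).top f) i = -C.sign (ω.top f) i := by
  have h1 : ((ω.flip (C.edge i, f (C.edge i))).top f) (C.edge i) =
      (ω.top f (C.edge i)).reverse := Stacks.flip_same _ ω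
  unfold sign
  rw [h1]
  have hne := C.vert_succ_ne i
  rcases Arrow.tail_or_head (ω.top f (C.edge i)) ((C.isLink i).mono C.le) with h | h
  · simp [Arrow.reverse, h.1, h.2, hne]
  · simp [Arrow.reverse, h.1, h.2, hne]

lemma sign_flip_of_ne (ω : G.Stacks) {i j : ZMod n} (hij : i ≠ j) (f : E(G) → ℕ) (m : ℕ) :
    C.sign ((ω.flip (C.edge j, m)).top f) i = C.sign (ω.top f) i := by
  have h1 : ((ω.flip (C.edge j, m)).top f) (C.edge i) = ω.top f (C.edge i) :=
    Stacks.flip_of_ne (fun h => hij (C.edge_injective (congrArg Prod.fst h))) ω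
  unfold sign
  rw [h1]

lemma sign_top_congr (ω : G.Stacks) {i : ZMod n} {f g : E(G) → ℕ}
    (h : f (C.edge i) = g (C.edge i)) : C.sign (ω.top f) i = C.sign (ω.top g) i := by
  have h' : ω.top f (C.edge i) = ω.top g (C.edge i) := by
    simp only [Stacks.top]
    rw [h]
  unfold sign
  rw [h']

lemma integral_sign_zero [Finite E(G)] (i : ZMod n) (f : E(G) → ℕ) :
    ∫ ω, C.sign (ω.top f) i ∂G.stackMeasure = 0 :=
  integral_eq_zero_of_flip (integrable_comp_of_finite (measurable_top_const f) (C.sign · i))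
    (C.edge i, f (C.edge i)) fun ω => C.sign_flip_same ω i f

lemma integral_sign_mul_sign [Finite E(G)] {i j : ZMod n} (hij : i ≠ j) (f : E(G) → ℕ) :
    ∫ ω, C.sign (ω.top f) i * C.sign (ω.top f) j ∂G.stackMeasure = 0 :=
  integral_eq_zero_of_flip (integrable_comp_of_finite (measurable_top_const f)
    fun o => C.sign o i * C.sign o j) (C.edge i, f (C.edge i)) fun ω => by
      rw [C.sign_flip_same ω i f, C.sign_flip_of_ne ω hij.symm, neg_mul]

variable [Nonempty α] [NeZero n]

/-- The potential of the canonical process at time `k`. -/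
noncomputable def energy (i₀ : ZMod n) (k : ℕ) (ω : G.Stacks) : ℝ :=
  potential i₀ (C.sign (ω.top (canonDepth H ω k)))

/-- The change of the potential when `C.vert i` is popped, in terms of the old and new
orientations. -/
noncomputable def increment (i₀ i : ZMod n) (o o' : G.Orientation) : ℝ :=
  C.sign o' (i - 1) * (coeff i₀ (i - 1) - (∑ j, C.sign o j) / n) +
    C.sign o' i * (coeff i₀ i - (∑ j, C.sign o j) / n) +
      C.sign o' (i - 1) * (-C.sign o' i / n)

/-- Depth `+ 1` on all edges is harmless: `increment` reads the new orientation only at the two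
edges that were really popped. -/
lemma energy_step_of_mem (i₀ i : ZMod n) (k : ℕ) {ω : G.Stacks}
    (h : ω ∈ canonPopped G H k (C.vert i)) :
    C.energy i₀ (k + 1) ω - C.energy i₀ k ω + (if i = i₀ then 1 else 0) =
      C.increment i₀ i (ω.top (canonDepth H ω k)) (ω.top (canonDepth H ω k + 1)) := by
  obtain ⟨hs, hv⟩ := mem_canonPopped.1 h
  have hsink := Classical.epsilon_spec hs
  rw [hv] at hsink
  obtain ⟨h1, h2⟩ := (C.subSink_iff _ i).1 hsink
  have hd : canonDepth H ω (k + 1) = pop (subInc G H) (C.vert i) (canonDepth H ω k) := by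
    rw [canonDepth_succ, canonStep, if_pos hs, hv]
  set f := canonDepth H ω k
  have hnew : ∀ j, j = i - 1 ∨ j = i →
      C.sign (ω.top (canonDepth H ω (k + 1))) j = C.sign (ω.top (f + 1)) j := by
    intro j hj
    have hinc : subInc G H (C.edge j) (C.vert i) := by
      refine (C.inc_iff _ i).2 ?_
      rcases hj with rfl | rfl <;> simp
    refine C.sign_top_congr ω ?_
    rw [hd]
    simp [pop, hinc]
  have hold : ∀ j, j ≠ i - 1 → j ≠ i →
      C.sign (ω.top (canonDepth H ω (k + 1))) j = C.sign (ω.top f) j := by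
    intro j hj hj'
    have hinc : ¬ subInc G H (C.edge j) (C.vert i) := by
      intro h
      rcases (C.inc_iff _ i).1 h with h | h
      · exact hj (C.edge_injective h)
      · exact hj' (C.edge_injective h)
    refine C.sign_top_congr ω ?_
    rw [hd]
    simp [pop, hinc]
  have := potential_step C.two_le i₀ i h1 h2 hold (C.sign_sq _ _) (C.sign_sq _ _)
  rw [hnew _ (Or.inl rfl), hnew _ (Or.inr rfl)] at this
  exact this

variable [Finite E(G)]

lemma energy_bounded (i₀ : ZMod n) : ∃ B, ∀ k ω, |C.energy i₀ k ω| ≤ B := by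
  obtain ⟨B, hB⟩ := Finite.bddAbove_range fun o : G.Orientation => |potential i₀ (C.sign o)|
  exact ⟨B, fun k ω => hB ⟨_, rfl⟩⟩

lemma integrable_energy (i₀ : ZMod n) (k : ℕ) :
    Integrable (C.energy i₀ k) G.stackMeasure :=
  integrable_comp_of_finite (measurable_top (measurable_canonDepth H k))
    fun o => potential i₀ (C.sign o)

/-- The initial signs are centred and pairwise uncorrelated, so only the constant of `potential_eq`
survives. -/
lemma integral_energy_zero (i₀ : ZMod n) :
    ∫ ω, C.energy i₀ 0 ω ∂G.stackMeasure = ((n : ℝ) - 1) / 2 := by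
  set f : E(G) → ℕ := fun _ => 0
  have hint : ∀ p : G.Orientation → ℝ, Integrable (fun ω : G.Stacks => p (ω.top f))
      G.stackMeasure := fun p => integrable_comp_of_finite (measurable_top_const f) p
  have h : ∀ ω : G.Stacks, C.energy i₀ 0 ω = ((n : ℝ) - 1) / 2 +
      ((∑ i, ∑ j, (if i = j then 0 else C.sign (ω.top f) i * C.sign (ω.top f) j)) *
        (-1 / (2 * n)) + ∑ i, coeff i₀ i * C.sign (ω.top f) i) :=
    fun ω => potential_eq i₀ (C.sign_sq (ω.top f))
  simp_rw [h]
  rw [integral_add (integrable_const _) (hint fun o => (∑ i, ∑ j, (if i = j then 0 else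
      C.sign o i * C.sign o j)) * (-1 / (2 * n)) + ∑ i, coeff i₀ i * C.sign o i),
    integral_add (hint fun o => (∑ i, ∑ j, (if i = j then 0 else
      C.sign o i * C.sign o j)) * (-1 / (2 * n))) (hint fun o => ∑ i, coeff i₀ i * C.sign o i),
    integral_mul_const,
    integral_finsetSum _ fun i _ => hint fun o => ∑ j, if i = j then 0 else
      C.sign o i * C.sign o j,
    integral_finsetSum _ fun i _ => hint fun o => coeff i₀ i * C.sign o i]
  have h1 : ∀ i : ZMod n, ∫ ω : G.Stacks, ∑ j, (if i = j then 0 else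
      C.sign (ω.top f) i * C.sign (ω.top f) j) ∂G.stackMeasure = 0 := by
    intro i
    rw [integral_finsetSum _ fun j _ => hint fun o => if i = j then 0 else
      C.sign o i * C.sign o j]
    refine Finset.sum_eq_zero fun j _ => ?_
    by_cases hij : i = j
    · simp [hij]
    · simp only [if_neg hij]
      exact C.integral_sign_mul_sign hij f
  have h2 : ∀ i : ZMod n, ∫ ω : G.Stacks, coeff i₀ i * C.sign (ω.top f) i ∂G.stackMeasure = 0 := by
    intro i
    rw [integral_const_mul, C.integral_sign_zero, mul_zero]
  simp [h1, h2]

/-- Each of the three terms is odd in a fresh sign: the first and third in that of edge `i - 1`, the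
second in that of edge `i`. -/
lemma integral_increment (i₀ i : ZMod n) (k : ℕ) (f : E(G) → ℕ) :
    ∫ ω, (canonEvent G H k f (C.vert i)).indicator
      (fun ω => C.increment i₀ i (ω.top f) (ω.top (f + 1))) ω ∂G.stackMeasure = 0 := by
  have hint : ∀ q : G.Orientation → G.Orientation → ℝ,
      Integrable ((canonEvent G H k f (C.vert i)).indicator
        fun ω => q (ω.top f) (ω.top (f + 1))) G.stackMeasure := fun q =>
    (integrable_comp_of_finite ((measurable_top_const f).prodMk
      (measurable_top_const (f + 1))) fun p => q p.1 p.2).indicator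
        (measurableSet_canonEvent k f _)
  have hne := C.sub_one_ne i
  let q₁ : G.Orientation → G.Orientation → ℝ := fun o o' =>
    C.sign o' (i - 1) * (coeff i₀ (i - 1) - (∑ j, C.sign o j) / n)
  let q₂ : G.Orientation → G.Orientation → ℝ := fun o o' =>
    C.sign o' i * (coeff i₀ i - (∑ j, C.sign o j) / n)
  let q₃ : G.Orientation → G.Orientation → ℝ := fun o o' =>
    C.sign o' (i - 1) * (-C.sign o' i / n)
  have h1 := integral_canonEvent_eq_zero (H := H) k f (C.vert i) (C.edge (i - 1)) q₁ fun ω => by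
    simp only [q₁]
    rw [show f (C.edge (i - 1)) + 1 = (f + 1) (C.edge (i - 1)) from rfl, C.sign_flip_same, neg_mul]
  have h2 := integral_canonEvent_eq_zero (H := H) k f (C.vert i) (C.edge i) q₂ fun ω => by
    simp only [q₂]
    rw [show f (C.edge i) + 1 = (f + 1) (C.edge i) from rfl, C.sign_flip_same, neg_mul]
  have h3 := integral_canonEvent_eq_zero (H := H) k f (C.vert i) (C.edge (i - 1)) q₃ fun ω => by
    simp only [q₃]
    rw [show f (C.edge (i - 1)) + 1 = (f + 1) (C.edge (i - 1)) from rfl, C.sign_flip_same,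
      C.sign_flip_of_ne ω hne.symm, neg_mul]
  have hsum : ((canonEvent G H k f (C.vert i)).indicator
      fun ω => C.increment i₀ i (ω.top f) (ω.top (f + 1))) =
      ((canonEvent G H k f (C.vert i)).indicator fun ω => q₁ (ω.top f) (ω.top (f + 1))) +
      ((canonEvent G H k f (C.vert i)).indicator fun ω => q₂ (ω.top f) (ω.top (f + 1))) +
      ((canonEvent G H k f (C.vert i)).indicator fun ω => q₃ (ω.top f) (ω.top (f + 1))) := by
    rw [← Set.indicator_add', ← Set.indicator_add']
    rfl
  rw [hsum, integral_add' ((hint q₁).add (hint q₂)) (hint q₃), integral_add' (hint q₁) (hint q₂),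
    h1, h2, h3]
  simp

end CycleLabelling

end Graph

/-! ### The expected number of pops on a cycle -/

namespace Graph

open Popping CyclePotential Filter Topology

variable {α β : Type*} {G H : Graph α β} {n : ℕ}

lemma lintegral_canonCount [Nonempty α] [Finite E(G)] (v : α) :
    ∫⁻ ω : G.Stacks, canonCount H v ω ∂G.stackMeasure =
      ∑' k, G.stackMeasure (canonPopped G H k v) := by
  simp_rw [canonCount_eq_tsum]
  rw [lintegral_tsum fun k => (measurable_one.indicator
    (measurableSet_canonPopped H k v)).aemeasurable]
  exact tsum_congr fun k => lintegral_indicator_one (measurableSet_canonPopped H k v)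

namespace CycleLabelling

variable (C : CycleLabelling G H n) [Nonempty α] [NeZero n]

-- Splitting by depths and popped vertex makes the depths deterministic on each piece, as the
-- reversal argument needs.
open Classical in
lemma energy_step (i₀ : ZMod n) (k : ℕ) (F : Finset (E(G) → ℕ))
    (hF : ∀ ω : G.Stacks, canonDepth H ω k ∈ F) (ω : G.Stacks) :
    C.energy i₀ (k + 1) ω - C.energy i₀ k ω +
        (canonPopped G H k (C.vert i₀)).indicator 1 ω =
      ∑ f ∈ F, ∑ i, (canonEvent G H k f (C.vert i)).indicator
        (fun ω => C.increment i₀ i (ω.top f) (ω.top (f + 1))) ω := by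
  by_cases hs : ∃ u, (ω.top (canonDepth H ω k)).SubSink H u
  · have hmem := (Classical.epsilon_spec hs).1
    rw [← C.vert_range] at hmem
    obtain ⟨i, hi⟩ := hmem
    have hpop : ∀ j, ω ∈ canonPopped G H k (C.vert j) ↔ i = j := by
      intro j
      rw [mem_canonPopped, ← hi]
      exact ⟨fun h => C.vert_injective h.2, fun h => ⟨hs, congrArg _ h⟩⟩
    rw [Finset.sum_eq_single_of_mem _ (hF ω) (fun f _ hf => Finset.sum_eq_zero fun j _ =>
      Set.indicator_of_notMem (fun h => hf h.1.symm) _),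
      Fintype.sum_eq_single i (fun j hj =>
        Set.indicator_of_notMem (fun h => hj ((hpop j).1 h.2).symm) _),
      Set.indicator_of_mem (show ω ∈ canonEvent G H k _ (C.vert i) from ⟨rfl, (hpop i).2 rfl⟩),
      ← C.energy_step_of_mem i₀ i k ((hpop i).2 rfl)]
    congr 1
    simp [Set.indicator, hpop]
  · have hpop : ∀ v, ω ∉ canonPopped G H k v := fun v h => hs h.1
    have hd : canonDepth H ω (k + 1) = canonDepth H ω k := by
      rw [canonDepth_succ, canonStep, if_neg hs]
    rw [Set.indicator_of_notMem (hpop _), energy, energy, hd, sub_self, add_zero,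
      Finset.sum_eq_zero fun f _ => Finset.sum_eq_zero fun j _ =>
        Set.indicator_of_notMem (fun h => hpop _ h.2) _]

variable [Finite E(G)]

lemma integral_energy_succ (i₀ : ZMod n) (k : ℕ) :
    ∫ ω, C.energy i₀ (k + 1) ω ∂G.stackMeasure + G.stackMeasure.real
      (canonPopped G H k (C.vert i₀)) = ∫ ω, C.energy i₀ k ω ∂G.stackMeasure := by
  classical
  have := Fintype.ofFinite E(G)
  have hm := measurableSet_canonPopped (G := G) H k (C.vert i₀)
  have hF : ∀ ω : G.Stacks, canonDepth H ω k ∈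
      Fintype.piFinset fun _ : E(G) => Finset.range (k + 1) := fun ω =>
    Fintype.mem_piFinset.2 fun e => Finset.mem_range.2 (Nat.lt_succ_of_le (canonDepth_le ω k e))
  have hint : ∀ f i, Integrable ((canonEvent G H k f (C.vert i)).indicator
      fun ω => C.increment i₀ i (ω.top f) (ω.top (f + 1))) G.stackMeasure := fun f i =>
    (integrable_comp_of_finite ((measurable_top_const f).prodMk
      (measurable_top_const (f + 1))) fun p => C.increment i₀ i p.1 p.2).indicator
        (measurableSet_canonEvent k f _)
  have h0 : ∫ ω, (C.energy i₀ (k + 1) ω - C.energy i₀ k ω +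
      (canonPopped G H k (C.vert i₀)).indicator 1 ω) ∂G.stackMeasure = 0 := by
    simp_rw [C.energy_step i₀ k _ hF]
    rw [integral_finsetSum _ fun f _ => integrable_finsetSum _ fun i _ => hint f i]
    refine Finset.sum_eq_zero fun f _ => ?_
    rw [integral_finsetSum _ fun i _ => hint f i]
    exact Finset.sum_eq_zero fun i _ => C.integral_increment i₀ i k f
  have hadd := integral_add ((C.integrable_energy i₀ (k + 1)).sub (C.integrable_energy i₀ k))
    (show Integrable ((canonPopped G H k (C.vert i₀)).indicator (1 : G.Stacks → ℝ)) G.stackMeasure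
      from (integrable_const (1 : ℝ)).indicator hm)
  simp only [Pi.sub_apply] at hadd
  rw [hadd, integral_sub (C.integrable_energy i₀ (k + 1)) (C.integrable_energy i₀ k),
    integral_indicator_one hm] at h0
  linarith

lemma sum_measure_canonPopped (i₀ : ZMod n) (k : ℕ) :
    ∑ j ∈ Finset.range k, G.stackMeasure.real (canonPopped G H j (C.vert i₀)) =
      ((n : ℝ) - 1) / 2 - ∫ ω, C.energy i₀ k ω ∂G.stackMeasure := by
  induction k with
  | zero => rw [C.integral_energy_zero]; simp
  | succ k ih =>
    rw [Finset.sum_range_succ, ih, ← C.integral_energy_succ i₀ k]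
    ring

lemma summable_measure_canonPopped (i₀ : ZMod n) :
    Summable fun j => G.stackMeasure.real (canonPopped G H j (C.vert i₀)) := by
  obtain ⟨B, hB⟩ := C.energy_bounded i₀
  refine summable_of_sum_range_le (c := ((n : ℝ) - 1) / 2 + B) (fun _ => measureReal_nonneg)
    fun k => ?_
  rw [C.sum_measure_canonPopped]
  have h : ‖∫ ω, C.energy i₀ k ω ∂G.stackMeasure‖ ≤ B * G.stackMeasure.real Set.univ :=
    norm_integral_le_of_norm_le_const (Filter.Eventually.of_forall (hB k))
  rw [probReal_univ, mul_one, Real.norm_eq_abs] at h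
  linarith [neg_abs_le (∫ ω, C.energy i₀ k ω ∂G.stackMeasure)]

lemma tsum_measure_canonPopped (i₀ : ZMod n) :
    ∑' k, G.stackMeasure (canonPopped G H k (C.vert i₀)) =
      ENNReal.ofReal (∑' k, G.stackMeasure.real (canonPopped G H k (C.vert i₀))) := by
  rw [ENNReal.ofReal_tsum_of_nonneg (fun _ => measureReal_nonneg)
    (C.summable_measure_canonPopped i₀)]
  simp

/-- Bounded energy gives each vertex a finite expected count, hence an almost surely finite one. -/
lemma ae_canonTerminates (C : CycleLabelling G H n) : ∀ᵐ ω ∂G.stackMeasure, CanonTerminates H ω := by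
  have h : ∀ i : ZMod n, ∀ᵐ ω ∂G.stackMeasure, canonCount H (C.vert i) ω < ⊤ := by
    intro i
    refine ae_lt_top (measurable_canonCount H _) ?_
    rw [lintegral_canonCount, C.tsum_measure_canonPopped]
    exact ENNReal.ofReal_ne_top
  filter_upwards [ae_all_iff.2 h] with ω hω
  refine canonTerminates_of_ne_top (C.vert_range ▸ Set.finite_range _) fun v hv => ?_
  rw [← C.vert_range] at hv
  obtain ⟨i, rfl⟩ := hv
  exact (hω i).ne

lemma tendsto_integral_energy (i₀ : ZMod n) :
    Tendsto (fun k => ∫ ω, C.energy i₀ k ω ∂G.stackMeasure) atTop (𝓝 0) := by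
  obtain ⟨B, hB⟩ := C.energy_bounded i₀
  rw [← integral_zero G.Stacks ℝ (μ := G.stackMeasure)]
  refine tendsto_integral_of_dominated_convergence (fun _ => B)
    (fun k => (C.integrable_energy i₀ k).aestronglyMeasurable) (integrable_const B)
    (fun k => Filter.Eventually.of_forall (hB k)) ?_
  filter_upwards [C.ae_canonTerminates] with ω hω
  obtain ⟨N, hN⟩ := hω
  refine tendsto_const_nhds.congr' ?_
  filter_upwards [eventually_ge_atTop N] with k hk
  exact (C.potential_eq_zero_of_not_sink i₀ (not_sink_of_le hk hN)).symm

lemma lintegral_canonCount_eq (i₀ : ZMod n) :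
    ∫⁻ ω : G.Stacks, canonCount H (C.vert i₀) ω ∂G.stackMeasure =
      ENNReal.ofReal (((n : ℝ) - 1) / 2) := by
  rw [lintegral_canonCount, C.tsum_measure_canonPopped]
  congr 1
  refine tendsto_nhds_unique (C.summable_measure_canonPopped i₀).hasSum.tendsto_sum_nat ?_
  simp_rw [C.sum_measure_canonPopped]
  simpa using (C.tendsto_integral_energy i₀).const_sub (((n : ℝ) - 1) / 2)

end CycleLabelling

lemma IsNCycle.nonempty_cycleLabelling (hHG : H ≤ G) (h : H.IsNCycle n) (hn : 2 ≤ n) :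
    Nonempty (CycleLabelling G H n) := by
  obtain ⟨-, v, e, hv, he, hvr, her, hl⟩ := h
  exact ⟨{
    vert := v
    edge := fun i => ⟨e i, ((hl i).mono hHG).edge_mem⟩
    le := hHG
    two_le := hn
    vert_injective := hv
    edge_injective := fun i j hij => he (congrArg Subtype.val hij)
    vert_range := hvr
    edge_range := fun e' he' => by
      rw [← her] at he'
      obtain ⟨i, hi⟩ := he'
      exact ⟨i, Subtype.ext hi.symm⟩
    isLink := hl }⟩

/-- Canonical sink popping on a cycle. -/
lemma IsNCycle.canon [Nonempty α] [Finite E(G)] (hHG : H ≤ G) (h : H.IsNCycle n) :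
    (∀ᵐ ω ∂G.stackMeasure, CanonTerminates H ω) ∧ ∀ v ∈ V(H),
      ∫⁻ ω : G.Stacks, canonCount H v ω ∂G.stackMeasure = ENNReal.ofReal (((n : ℝ) - 1) / 2) := by
  obtain ⟨hn, v, e, hv, he, hvr, her, hl⟩ := h
  have : NeZero n := ⟨by omega⟩
  -- A loop always has its vertex as tail, so for `n = 1` nothing is ever popped and both sides are
  -- `0`.
  rcases hn.eq_or_lt with rfl | hn
  · have hs : ∀ (o : G.Orientation) u, ¬ o.SubSink H u := by
      intro o u hu
      have hmem := hu.1
      rw [← hvr] at hmem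
      obtain ⟨i, rfl⟩ := hmem
      have hloop : H.IsLink (e i) (v i) (v i) := by
        have := hl i
        rwa [Subsingleton.elim (i + 1) i] at this
      have htail := Arrow.tail_or_head (o ⟨e i, (hloop.mono hHG).edge_mem⟩) (hloop.mono hHG)
      exact hu.2 _ hloop.inc_left (htail.elim And.left And.left)
    refine ⟨Filter.Eventually.of_forall fun ω => ⟨0, fun u => hs _ u⟩, fun u _ => ?_⟩
    have : ∀ k, canonPopped G H k u = ∅ := fun k =>
      Set.eq_empty_of_forall_notMem fun ω hω => hs _ _ hω.1.choose_spec
    simp [lintegral_canonCount, this]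
  · obtain ⟨C⟩ := IsNCycle.nonempty_cycleLabelling hHG ⟨hn.le, v, e, hv, he, hvr, her, hl⟩ hn
    refine ⟨C.ae_canonTerminates, fun u hu => ?_⟩
    rw [← C.vert_range] at hu
    obtain ⟨i, rfl⟩ := hu
    exact C.lintegral_canonCount_eq i

end Graph

/-! ### The equality case and the theorem -/

namespace Graph

open Popping

variable {α β : Type*} {G H : Graph α β} {n : ℕ}

lemma measure_top_zero_ne_zero [Finite E(G)] (o : G.Orientation) :
    G.stackMeasure {ω | ω.top (fun _ => 0) = o} ≠ 0 := by
  classical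
  have := Fintype.ofFinite E(G)
  let s : Finset (E(G) × ℕ) := Finset.univ.image fun e => (e, 0)
  have hB : {ω : G.Stacks | ω.top (fun _ => 0) = o} =
      Set.pi (s : Set (E(G) × ℕ)) fun i => ({o i.1} : Set (G.Arrow i.1)) := by
    ext ω
    simp only [Set.mem_ofPred_eq, Set.mem_pi, Set.mem_singleton_iff, Finset.mem_coe, s,
      Finset.mem_image, Finset.mem_univ, true_and]
    constructor
    · rintro rfl _ ⟨e, rfl⟩
      rfl
    · intro h
      funext e
      exact h (e, 0) ⟨e, rfl⟩
  rw [hB, stackMeasure, Measure.infinitePi_pi _ fun i _ => measurableSet_singleton _,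
    Finset.prod_ne_zero_iff]
  intro i _
  have := Fintype.ofFinite (G.Arrow i.1)
  rw [uniformOn_univ, Measure.count_singleton]
  simp

lemma ChoiceRule.numPops_eq_zero (r : G.ChoiceRule) {ω : G.Stacks}
    (h : ∀ v, ¬ (ω.top fun _ => 0).SubSink G v) (v : α) : r.numPops v ω = 0 := by
  rw [r.numPops_eq, popCount]
  have : {k : ℕ | Popped (subInc G G) (ω.SubSink G) (r.choose ω) k v} = ∅ := by
    refine Set.eq_empty_of_forall_notMem fun k hk => ?_
    obtain ⟨u, hu⟩ := hk.1
    exact not_sink_of_le (Nat.zero_le k) h u hu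
  simp [this]

/-- If an additional edge leaves a vertex of a spanning cycle, then in some orientation this
vertex is the only sink of the cycle, but not a sink of `G`. -/
lemma CycleLabelling.exists_orientation (C : CycleLabelling G H n) (hV : V(H) = V(G))
    {e' : E(G)} (he' : e'.1 ∉ E(H)) :
    ∃ (i : ZMod n) (o : G.Orientation), o.SubSink H (C.vert i) ∧ ∀ v, ¬ o.SubSink G v := by
  classical
  obtain ⟨x, y, hxy⟩ := exists_isLink_of_mem_edgeSet e'.2
  have hx := hxy.left_mem
  rw [← hV, ← C.vert_range] at hx
  obtain ⟨i, rfl⟩ := hx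
  -- Edge `i - 1` points forward and all other cycle edges backward, so both edges at `C.vert i`
  -- point into it and every other vertex `j` is the tail of edge `j - 1`; `e'` leaves `C.vert i`.
  have harrow : ∀ e : E(G), ∃ a : G.Arrow e, (e = e' → a.tail = C.vert i) ∧
      ∀ j, e = C.edge j → a.tail = if j = i - 1 then C.vert j else C.vert (j + 1) := by
    intro e
    by_cases h : e.1 ∈ E(H)
    · obtain ⟨j, rfl⟩ := C.edge_range e h
      have hl := (C.isLink j).mono C.le
      refine ⟨if j = i - 1 then ⟨_, _, hl⟩ else ⟨_, _, hl.symm⟩, ?_, ?_⟩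
      · rintro rfl
        exact absurd h he'
      · intro k hk
        obtain rfl := C.edge_injective hk
        split_ifs <;> rfl
    · have hk : ∀ j, e ≠ C.edge j := by
        rintro j rfl
        exact h (C.isLink j).edge_mem
      by_cases hee : e = e'
      · subst hee
        exact ⟨⟨_, _, hxy⟩, fun _ => rfl, fun j hj => absurd hj (hk j)⟩
      · exact ⟨Classical.arbitrary _, fun h => absurd h hee, fun j hj => absurd hj (hk j)⟩
  choose o ho1 ho2 using harrow
  refine ⟨i, o, ?_, fun u hu => ?_⟩
  · rw [C.subSink_iff, C.sign_eq_one_iff, C.sign_eq_neg_one_iff, ho2 _ _ rfl, ho2 _ _ rfl,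
      if_pos rfl, if_neg (C.sub_one_ne i).symm]
    exact ⟨(C.vert_succ_ne _).symm, C.vert_succ_ne i⟩
  · have hmem := hu.1
    rw [← hV, ← C.vert_range] at hmem
    obtain ⟨j, rfl⟩ := hmem
    by_cases hj : j = i
    · subst hj
      exact hu.2 e' hxy.inc_left (ho1 e' rfl)
    · refine hu.2 (C.edge (j - 1)) ((C.isLink' j).mono C.le).inc_right ?_
      rw [ho2 _ _ rfl, if_neg (fun h => hj (sub_left_injective h)), sub_add_cancel]

section

variable [Nonempty α] [Finite E(G)]

lemma IsNCycle.lintegral_numPops_le (hHG : H ≤ G) (h : H.IsNCycle n) (r : G.ChoiceRule) {v : α}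
    (hv : v ∈ V(H)) :
    ∫⁻ ω, r.numPops v ω ∂G.stackMeasure ≤ ENNReal.ofReal (((n : ℝ) - 1) / 2) := by
  obtain ⟨hT, hc⟩ := h.canon hHG
  rw [← hc v hv]
  refine lintegral_mono_ae ?_
  filter_upwards [hT] with ω hω
  exact numPops_le_canonCount hHG r hω hv

/-- On the event that the top arrows form the orientation of `exists_orientation`, `G` pops nothing
while the cycle pops `C.vert i` at least once. -/
lemma IsNCycle.exists_lintegral_numPops_lt (hHG : H ≤ G) (h : H.IsNCycle n) (hn : 2 ≤ n)
    (hV : V(H) = V(G)) {e' : β} (he : e' ∈ E(G)) (he' : e' ∉ E(H)) (r : G.ChoiceRule) :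
    ∃ v ∈ V(G), ∫⁻ ω, r.numPops v ω ∂G.stackMeasure < ENNReal.ofReal (((n : ℝ) - 1) / 2) := by
  obtain ⟨C⟩ := h.nonempty_cycleLabelling hHG hn
  obtain ⟨hT, hc⟩ := h.canon hHG
  obtain ⟨i, o, ho, ho'⟩ := C.exists_orientation hV (e' := ⟨e', he⟩) he'
  have hv := C.vert_mem i
  refine ⟨C.vert i, hV ▸ hv, ?_⟩
  rw [← hc _ hv]
  refine lintegral_strict_mono_of_ae_le_of_ae_lt_on (measurable_canonCount H _).aemeasurable ?_ ?_
    (measure_top_zero_ne_zero o) ?_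
  · exact ne_top_of_le_ne_top ENNReal.ofReal_ne_top (h.lintegral_numPops_le hHG r hv)
  · filter_upwards [hT] with ω hω
    exact numPops_le_canonCount hHG r hω hv
  · filter_upwards [hT] with ω hω hB
    have hB' : ω.top (fun _ => 0) = o := hB
    rw [r.numPops_eq_zero (hB' ▸ ho')]
    refine zero_lt_one.trans_le (one_le_popCount (isLocal_subSink hHG ω) (valid_canonChoice H ω)
      hω ?_)
    exact (hB' ▸ ho : (ω.top fun _ => 0).SubSink H (C.vert i))

/-- If every vertex lies on a cycle, then almost surely all choice rules pop every vertex equally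
often. -/
lemma ae_numPops_eq_canonCount (hV : V(G).Finite)
    (hcyc : ∀ v ∈ V(G), ∃ H : Graph α β, H ≤ G ∧ v ∈ V(H) ∧ ∃ k : ℕ, H.IsNCycle k)
    (r : G.ChoiceRule) :
    ∀ᵐ ω ∂G.stackMeasure, ∀ v ∈ V(G), r.numPops v ω = canonCount G v ω := by
  have hfin : ∀ᵐ ω ∂G.stackMeasure, ∀ v ∈ V(G), canonCount G v ω ≠ ⊤ := by
    refine (ae_ball_iff hV.countable).2 fun v hv => ?_
    obtain ⟨H, hHG, hvH, k, hk⟩ := hcyc v hv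
    obtain ⟨hT, hc⟩ := hk.canon hHG
    have hlt : ∀ᵐ ω ∂G.stackMeasure, canonCount H v ω < ⊤ :=
      ae_lt_top (measurable_canonCount H v) (by rw [hc v hvH]; exact ENNReal.ofReal_ne_top)
    filter_upwards [hT, hlt] with ω h1 h2
    exact ((canonCount_self_le hHG h1 hvH).trans_lt h2).ne
  filter_upwards [hfin] with ω hω v hv
  exact numPops_eq_canonCount hV r (canonTerminates_of_ne_top hV hω) hv hω

end

lemma ofReal_sub_one_div_two (n : ℕ) :
    ENNReal.ofReal (((n : ℝ) - 1) / 2) = ((n : ℝ≥0∞) - 1) / 2 := by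
  rw [ENNReal.ofReal_div_of_pos two_pos, ENNReal.ofReal_sub _ zero_le_one]
  simp

lemma IsNCycle.ncard_vertexSet (h : H.IsNCycle n) : V(H).ncard = n := by
  obtain ⟨hn, v, -, hv, -, hvr, -⟩ := h
  have : NeZero n := ⟨by omega⟩
  rw [← hvr, ← Set.image_univ, Set.ncard_image_of_injective _ hv, Set.ncard_univ, Nat.card_zmod]

lemma IsNCycle.of_edgeSet_eq (hHG : H ≤ G) (h : H.IsNCycle n) (hV : V(H) = V(G))
    (hE : E(H) = E(G)) : G.IsNCycle n := by
  obtain ⟨hn, v, e, hv, he, hvr, her, hl⟩ := h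
  exact ⟨hn, v, e, hv, he, hvr.trans hV, her.trans hE, fun i => (hl i).mono hHG⟩

/-- A spanning `1`-cycle is the whole graph if there are no multiple loops. -/
lemma IsNCycle.edgeSet_eq_of_one (hHG : H ≤ G) (h : H.IsNCycle 1) (hV : V(H) = V(G))
    (hloop : ∀ v, (G.loopSet v).Subsingleton) : E(H) = E(G) := by
  obtain ⟨-, v, e, -, -, hvr, -, hl⟩ := h
  have hl0 : H.IsLink (e 0) (v 0) (v 0) := by
    have := hl 0
    rwa [Subsingleton.elim (0 + 1 : ZMod 1) 0] at this
  have hmem : ∀ x ∈ V(G), x = v 0 := by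
    intro x hx
    rw [← hV, ← hvr] at hx
    obtain ⟨i, rfl⟩ := hx
    rw [Subsingleton.elim i 0]
  refine (IsSubgraph.edgeSet_mono hHG).antisymm fun e' he' => ?_
  obtain ⟨x, y, hxy⟩ := exists_isLink_of_mem_edgeSet he'
  rw [hmem x hxy.left_mem, hmem y hxy.right_mem] at hxy
  rw [hloop (v 0) hxy (hl0.mono hHG)]
  exact hl0.edge_mem

end Graph

theorem mainTheorem8 {α β : Type*} (G : Graph α β)
    (hV : V(G).Finite) (hE : E(G).Finite) (hne : V(G).Nonempty)
    (hloop : ∀ v, (G.loopSet v).Subsingleton)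
    (hcyc : ∀ v ∈ V(G), ∃ H : Graph α β, H ≤ G ∧ v ∈ V(H) ∧ ∃ k : ℕ, H.IsNCycle k)
    (r : G.ChoiceRule) :
    (∀ v ∈ V(G), AEMeasurable (r.numPops v) G.stackMeasure ∧
      ∫⁻ ω, r.numPops v ω ∂G.stackMeasure ≤ ((V(G).ncard : ℝ≥0∞) - 1) / 2) ∧
    ((∀ v ∈ V(G), ∫⁻ ω, r.numPops v ω ∂G.stackMeasure = ((V(G).ncard : ℝ≥0∞) - 1) / 2) ↔
      G.IsNCycle V(G).ncard) := by
  have hα : Nonempty α := ⟨hne.some⟩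
  have hfinE : Finite E(G) := hE
  have hae := Graph.ae_numPops_eq_canonCount hV hcyc r
  have hcard : ∀ {H : Graph α β} {k : ℕ}, H ≤ G → H.IsNCycle k → k ≤ V(G).ncard :=
    fun hHG hk => hk.ncard_vertexSet ▸ Set.ncard_le_ncard hHG.1 hV
  rw [← Graph.ofReal_sub_one_div_two]
  refine ⟨fun v hv => ⟨⟨Graph.canonCount G v, Graph.measurable_canonCount G v, ?_⟩, ?_⟩,
    fun h => ?_, fun h v hv => ?_⟩
  · filter_upwards [hae] with ω hω
    exact hω v hv
  · obtain ⟨H, hHG, hvH, k, hk⟩ := hcyc v hv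
    refine (hk.lintegral_numPops_le hHG r hvH).trans (ENNReal.ofReal_le_ofReal ?_)
    have : (k : ℝ) ≤ V(G).ncard := Nat.cast_le.2 (hcard hHG hk)
    linarith
  · obtain ⟨v, hv⟩ := hne
    obtain ⟨H, hHG, hvH, k, hk⟩ := hcyc v hv
    -- Equality at a single vertex already makes any cycle through it spanning, by the bound
    -- `(k-1)/2`.
    have hkn : k = V(G).ncard := by
      refine (hcard hHG hk).antisymm ?_
      have h1 := (h v hv).symm.trans_le (hk.lintegral_numPops_le hHG r hvH)
      have hk1 : (1 : ℝ) ≤ k := Nat.one_le_cast.2 hk.1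
      rw [ENNReal.ofReal_le_ofReal_iff (by linarith)] at h1
      have h2 : (V(G).ncard : ℝ) ≤ k := by linarith
      exact_mod_cast h2
    rw [← hkn] at h ⊢
    have hVH : V(H) = V(G) :=
      Set.eq_of_subset_of_ncard_le hHG.1 (by rw [hk.ncard_vertexSet, hkn]) hV
    refine hk.of_edgeSet_eq hHG hVH ?_
    rcases hk.1.eq_or_lt with rfl | hk2
    · exact hk.edgeSet_eq_of_one hHG hVH hloop
    · by_contra hEE
      obtain ⟨e', he, he'⟩ := Set.exists_of_ssubset
        ((Graph.IsSubgraph.edgeSet_mono hHG).ssubset_of_ne hEE)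
      obtain ⟨u, hu, hlt⟩ := hk.exists_lintegral_numPops_lt hHG hk2 hVH he he' r
      exact hlt.ne (h u hu)
  -- Here `G` itself serves as the cycle, and `r` pops as often as the canonical rule.
  · rw [← (h.canon le_rfl).2 v hv]
    refine lintegral_congr_ae ?_
    filter_upwards [hae] with ω hω
    exact hω v hv
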